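/- Let $2^{\mathbb N}$ be the Cantor set and let $H(2^{\mathbb N})$ be the group of all homeomorphisms of $2^{\mathbb N}$ onto itself, with composition, which is a topological group under the topology of uniform convergence (equivalently, the compact-open topology). Then $H(2^{\mathbb N})$ has ample generics: for every $m\in\mathbb N$, the diagonal conjugacy action \[ g\cdot(h_1,\ldots,h_m)=(g h_1 g^{-1},\ldots,g h_m g^{-1}) \] of $H(2^{\mathbb N})$ on $H(2^{\mathbb N})^m$ (with the product topology) has a comeager orbit, that is, an orbit that contains a countable intersection of dense open subsets of $H(2^{\mathbb N})^m$. -/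

import Mathlib

open Topology

/-- The topology on the group `X ≃ₜ X` of self-homeomorphisms of a compact Hausdorff space: the
compact-open topology, i.e. the topology of uniform convergence (for any compatible metric, when
`X` is metrizable). -/
instance instTopologicalSpaceHomeo (X : Type*) [TopologicalSpace X] [CompactSpace X] [T2Space X] :
    TopologicalSpace (X ≃ₜ X) :=
  TopologicalSpace.induced (fun f : X ≃ₜ X => (f : C(X, X))) inferInstance

/-- With this topology, `X ≃ₜ X` (with composition) is a topological group. -/
instance instIsTopologicalGroupHomeo (X : Type*) [TopologicalSpace X] [CompactSpace X]
    [T2Space X] : IsTopologicalGroup (X ≃ₜ X) where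
  continuous_mul := by
    have h : Continuous (fun f : X ≃ₜ X => (f : C(X, X))) := continuous_induced_dom
    refine continuous_induced_rng.2 ?_
    exact ContinuousMap.continuous_comp'.comp
      ((h.comp continuous_snd).prodMk (h.comp continuous_fst))
  continuous_inv := by
    have h : Continuous (fun f : X ≃ₜ X => (f : C(X, X))) := continuous_induced_dom
    refine continuous_induced_rng.2 (ContinuousMap.continuous_compactOpen.2 ?_)
    intro K hK U hU
    have key : {f : X ≃ₜ X | Set.MapsTo (((f⁻¹ : X ≃ₜ X) : C(X, X)) : X → X) K U} =
        (fun f : X ≃ₜ X => (f : C(X, X))) ⁻¹' {g : C(X, X) | Set.MapsTo g Uᶜ Kᶜ} := by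
      ext f
      constructor
      · intro hf x hx hxK
        apply hx
        have := hf hxK
        simpa using this
      · intro hf x hx
        by_contra hxU
        have := hf hxU
        apply this
        simpa using hx
    exact key ▸ (ContinuousMap.isOpen_setOfPred_mapsTo hU.isClosed_compl.isCompact
      hK.isClosed.isOpen_compl).preimage h

/-- A topological group `G` has `m`-ample generics if the diagonal conjugacy action
`g • (h₁, …, hₘ) = (g h₁ g⁻¹, …, g hₘ g⁻¹)` of `G` on `G ^ m` has a comeager orbit.
Here `ConjAct G` is `G` acting on itself by conjugation, and it acts coordinatewise on tuples. -/
def HasAmpleGenericsInDim (G : Type*) [Group G] [TopologicalSpace G] [IsTopologicalGroup G]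
    (m : ℕ) : Prop :=
  ∃ h : Fin m → G, MulAction.orbit (ConjAct G) h ∈ residual (Fin m → G)

/-- A topological group has ample generics if it has `m`-ample generics for every `m`. -/
def HasAmpleGenerics (G : Type*) [Group G] [TopologicalSpace G] [IsTopologicalGroup G] : Prop :=
  ∀ m : ℕ, HasAmpleGenericsInDim G m

/-!
Write `C` for the Cantor space `ℕ → Bool`. By Rosendal's criterion (`exists_orbit_mem_residual`), a
comeager diagonal conjugacy class of `m`-tuples exists once conjugation is topologically transitive
and, for each neighbourhood `V` of the identity, every nonempty open set of tuples contains a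
nonempty open set `U'` on which conjugation by elements of `V` is topologically transitive.

To show that tuples near `f` and near `f'` are conjugate, it suffices to find a *joining* of `f` and
`f'`: a closed invariant set `K ⊆ C × C` that projects onto both factors
(`exists_conj_of_joining`). Indeed `K × C` is a Cantor space by Brouwer's theorem, and both
projections to `C` become homeomorphisms after a small perturbation, so that the product system on
`K × C` is transported to a tuple near `f` and to one near `f'`. For transitivity, `K = C × C` will
do. If moreover a locally constant labelling `r` of `C` takes equal values at the two coordinates of
each point of `K`, the conjugating map preserves `r`, and it is close to the identity if `r` is fine.

So one needs an open set `U'` of tuples, inside a given one, such that for `f, f' ∈ U'` the pairs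
`(x, y)` with the same labels along all words in the free group of rank `m` form a joining. The set
`U'` consists of the tuples that realize a prescribed set of edges between labels. A label is
a pair of a colour, namely a prefix of a point of `C`, and a direction among the `2m` generators and
inverses. The direction says where a root of the Cayley tree of the free group is to be
found, and the colour of any neighbour away from the root is a fixed function of the current colour.
Two neighbours each of which sees the root beyond the other form a root edge; there every pair of
colours that is linked by the original tuple is allowed, so no tuple near the original one is asked
for a pattern which that one lacks (`RootedEdge`). As everything away from the root is determined,
any finite pattern of labels seen in `f'` is also seen in `f`: walk towards the root, far enough for
the pattern to lie entirely on the determined side, take a point with the label reached there and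
walk back (`exists_agreeUpTo`). By compactness, each `y` has a partner `x` with the same labels along
all words (`exists_forall_walk_eq`), which gives the joining.
-/

/-! ### Brouwer's characterisation of the Cantor space -/

theorem exists_separating_clopen_seq (Y : Type*) [TopologicalSpace Y] [CompactSpace Y] [T2Space Y]
    [TotallyDisconnectedSpace Y] [SecondCountableTopology Y] :
    ∃ c : ℕ → Set Y, (∀ n, IsClopen (c n)) ∧ ∀ x y, x ≠ y → ∃ n, x ∈ c n ∧ y ∉ c n := by
  obtain ⟨B, hBs, hBc, hB⟩ := (isTopologicalBasis_isClopen (X := Y)).exists_countable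
  obtain ⟨c, hc⟩ := (hBc.insert ∅).exists_eq_range (Set.insert_nonempty _ _)
  refine ⟨c, fun n => ?_, fun x y hxy => ?_⟩
  · have : c n ∈ insert ∅ B := hc ▸ Set.mem_range_self n
    rcases this with h | h
    · rw [h]; exact isClopen_empty
    · exact hBs h
  · obtain ⟨U, hU, hx, hUy⟩ := hB.exists_subset_of_mem_open
      (show x ∈ ({y}ᶜ : Set Y) from hxy) isOpen_compl_singleton
    have : U ∈ Set.range c := hc ▸ Set.mem_insert_of_mem _ hU
    obtain ⟨n, rfl⟩ := this
    exact ⟨n, hx, fun hy => hUy hy rfl⟩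

/-- A nonempty clopen subset `U` of a perfect profinite space is cut into two nonempty clopen
pieces, each contained in or disjoint from the given clopen set `c`. -/
theorem exists_clopen_split {Y : Type*} [TopologicalSpace Y] [CompactSpace Y] [T2Space Y]
    [TotallyDisconnectedSpace Y] [PerfectSpace Y] {c : Set Y} (hc : IsClopen c)
    (U : {U : Set Y // IsClopen U ∧ U.Nonempty}) :
    ∃ V : Bool → {U : Set Y // IsClopen U ∧ U.Nonempty},
      (V true).1 ⊆ U.1 ∧ (V false).1 = U.1 \ (V true).1 ∧
        ∀ b, (V b).1 ⊆ c ∨ (V b).1 ⊆ cᶜ := by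
  obtain ⟨U, hU, hne⟩ := U
  by_cases h : (U ∩ c).Nonempty ∧ (U \ c).Nonempty
  · refine ⟨fun b => bif b then ⟨U ∩ c, hU.inter hc, h.1⟩ else ⟨U \ c, hU.diff hc, h.2⟩, ?_⟩
    simp +contextual [Set.subset_def]
  · have hd : U ⊆ c ∨ U ⊆ cᶜ := by
      rw [not_and_or, Set.not_nonempty_iff_eq_empty, Set.not_nonempty_iff_eq_empty] at h
      rcases h with h | h
      · exact Or.inr (Set.disjoint_iff_inter_eq_empty.2 h).subset_compl_right
      · exact Or.inl (Set.sdiff_eq_empty.1 h)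
    obtain ⟨x, hx⟩ := hne
    obtain ⟨y, hy, hyx⟩ : ∃ y ∈ U, y ≠ x := by
      have h1 : (𝓝[≠] x).NeBot := inferInstance
      have h2 : U ∩ {x}ᶜ ∈ 𝓝[≠] x :=
        Filter.inter_mem (mem_nhdsWithin_of_mem_nhds (hU.isOpen.mem_nhds hx)) self_mem_nhdsWithin
      obtain ⟨y, hy, hyx⟩ := h1.nonempty_of_mem h2
      exact ⟨y, hy, hyx⟩
    obtain ⟨W, hW, hyW, hxW⟩ := exists_isClopen_of_totally_separated hyx
    refine ⟨fun b => bif b then ⟨U ∩ W, hU.inter hW, y, hy, hyW⟩ else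
      ⟨U \ W, hU.diff hW, x, hx, hxW⟩, Set.inter_subset_left, by simp, ?_⟩
    rintro (_ | _)
    · exact hd.imp Set.sdiff_subset.trans Set.sdiff_subset.trans
    · exact hd.imp Set.inter_subset_left.trans Set.inter_subset_left.trans

/-- Brouwer: a nonempty perfect profinite second countable space is the Cantor space. The
homeomorphism records the branch that a point follows in a binary tree of clopen sets. -/
theorem nonempty_homeomorph_nat_bool (Y : Type*) [TopologicalSpace Y] [CompactSpace Y] [T2Space Y]
    [TotallyDisconnectedSpace Y] [SecondCountableTopology Y] [PerfectSpace Y] [Nonempty Y] :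
    Nonempty (Y ≃ₜ (ℕ → Bool)) := by
  classical
  obtain ⟨c, hc, hsep⟩ := exists_separating_clopen_seq Y
  choose V hVt hVf hVc using fun n => exists_clopen_split (hc n)
  let top : {U : Set Y // IsClopen U ∧ U.Nonempty} := ⟨Set.univ, isClopen_univ, Set.univ_nonempty⟩
  -- the cell at level `n` along the branch `a`, and along the branch that follows the point `x`
  let D (a : ℕ → Bool) (n : ℕ) : {U : Set Y // IsClopen U ∧ U.Nonempty} :=
    Nat.rec top (fun n U => V n U (a n)) n
  let E (x : Y) (n : ℕ) : {U : Set Y // IsClopen U ∧ U.Nonempty} :=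
    Nat.rec top (fun n U => V n U (decide (x ∈ (V n U true).1))) n
  let φ (x : Y) (n : ℕ) : Bool := decide (x ∈ (V n (E x n) true).1)
  have hVsub : ∀ n U b, (V n U b).1 ⊆ U.1 := by
    rintro n U (_ | _)
    · rw [hVf]; exact Set.sdiff_subset
    · exact hVt n U
  have hmem : ∀ n U b x, x ∈ (V n U b).1 → decide (x ∈ (V n U true).1) = b := by
    rintro n U (_ | _) x hx
    · rw [hVf] at hx; simpa using hx.2
    · simpa using hx
  have hE : ∀ x n, x ∈ (E x n).1 := by
    intro x n
    induction n with
    | zero => trivial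
    | succ n ih =>
      change x ∈ (V n (E x n) (decide (x ∈ (V n (E x n) true).1))).1
      by_cases h : x ∈ (V n (E x n) true).1
      · rwa [decide_eq_true h]
      · rw [decide_eq_false h, hVf]; exact ⟨ih, h⟩
  have hED : ∀ x n, E x n = D (φ x) n := by
    intro x n
    induction n with
    | zero => rfl
    | succ n ih =>
      change V n (E x n) (φ x n) = V n (D (φ x) n) (φ x n)
      rw [ih]
  have hDE : ∀ x a n, x ∈ (D a n).1 → E x n = D a n ∧ ∀ k < n, φ x k = a k := by
    intro x a n
    induction n with
    | zero => exact fun _ => ⟨rfl, fun k hk => absurd hk (Nat.not_lt_zero k)⟩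
    | succ n ih =>
      intro hx
      have hx' : x ∈ (V n (D a n) (a n)).1 := hx
      obtain ⟨h1, h2⟩ := ih (hVsub _ _ _ hx')
      have h3 : φ x n = a n := by
        change decide (x ∈ (V n (E x n) true).1) = a n
        rw [h1]; exact hmem _ _ _ _ hx'
      refine ⟨?_, fun k hk => ?_⟩
      · change V n (E x n) (φ x n) = V n (D a n) (a n)
        rw [h1, h3]
      · rcases Nat.lt_succ_iff_lt_or_eq.1 hk with h | rfl
        exacts [h2 k h, h3]
  have hED' : ∀ x y n, y ∈ (E x n).1 → y ∈ (D (φ x) n).1 := fun x y n hy =>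
    (Set.ext_iff.1 (congrArg Subtype.val (hED x n)) y).1 hy
  have hcont : Continuous φ := by
    refine continuous_pi fun n => continuous_iff_continuousAt.2 fun x => ?_
    refine ContinuousAt.congr (f := fun _ => φ x n) continuousAt_const ?_
    filter_upwards [(E x (n + 1)).2.1.isOpen.mem_nhds (hE x (n + 1))] with y hy
    exact ((hDE y (φ x) (n + 1) (hED' x y (n + 1) hy)).2 n n.lt_succ_self).symm
  have hinj : Function.Injective φ := by
    intro x y hxy
    by_contra hne
    obtain ⟨n, hx, hy⟩ := hsep x y hne
    have hx1 := hED' x x (n + 1) (hE x (n + 1))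
    have hy1 := hED' y y (n + 1) (hE y (n + 1))
    rw [← hxy] at hy1
    rcases hVc n (D (φ x) n) (φ x n) with h | h
    · exact hy (h hy1)
    · exact h hx1 hx
  have hsurj : Function.Surjective φ := by
    intro a
    obtain ⟨x, hx⟩ := IsCompact.nonempty_iInter_of_sequence_nonempty_isCompact_isClosed
      (fun n => (D a n).1) (fun n => hVsub n (D a n) (a n)) (fun n => (D a n).2.2)
      (D a 0).2.1.isClosed.isCompact (fun n => (D a n).2.1.isClosed)
    refine ⟨x, funext fun n => ?_⟩
    exact (hDE x a (n + 1) (Set.mem_iInter.1 hx (n + 1))).2 n n.lt_succ_self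
  exact ⟨Continuous.homeoOfEquivCompactToT2 (f := Equiv.ofBijective φ ⟨hinj, hsurj⟩) hcont⟩

theorem perfectSpace_nat_bool : PerfectSpace (ℕ → Bool) := by
  rw [perfectSpace_iff_forall_not_isolated]
  intro x
  rw [← mem_closure_iff_nhdsWithin_neBot]
  refine mem_closure_of_tendsto (f := fun n : ℕ => Function.update x n (!x n)) (b := Filter.atTop)
    ?_ (Filter.Eventually.of_forall fun n h => ?_)
  · rw [tendsto_pi_nhds]
    intro k
    refine tendsto_const_nhds.congr' ?_
    filter_upwards [Filter.eventually_gt_atTop k] with n hn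
    rw [Function.update_of_ne hn.ne]
  · simpa using congrFun h n

theorem perfectSpace_prod_right (X Y : Type*) [TopologicalSpace X] [TopologicalSpace Y]
    [PerfectSpace Y] : PerfectSpace (X × Y) := by
  rw [perfectSpace_iff_forall_not_isolated]
  rintro ⟨x, y⟩
  have h : Filter.Tendsto (fun z => (x, z)) (𝓝[≠] y) (𝓝[≠] (x, y)) :=
    tendsto_nhdsWithin_iff.2 ⟨((by fun_prop : Continuous fun z : Y => (x, z)).tendsto y).mono_left
      nhdsWithin_le_nhds, by
        filter_upwards [self_mem_nhdsWithin] with z hz h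
        exact hz (congrArg Prod.snd h)⟩
  exact h.neBot

theorem IsOpen.perfectSpace_subtype {Y : Type*} [TopologicalSpace Y] [PerfectSpace Y] {U : Set Y}
    (hU : IsOpen U) : PerfectSpace U := by
  rw [perfectSpace_iff_forall_not_isolated]
  intro x
  rw [← mem_closure_iff_nhdsWithin_neBot, mem_closure_iff_nhds]
  intro t ht
  have h1 : (𝓝[≠] (x : Y)).NeBot := inferInstance
  have h2 : Subtype.val '' t ∈ 𝓝 (x : Y) := hU.isOpenEmbedding_subtypeVal.isOpenMap.image_mem_nhds ht
  obtain ⟨_, ⟨y, hy, rfl⟩, hyx⟩ :=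
    h1.nonempty_of_mem (Filter.inter_mem (mem_nhdsWithin_of_mem_nhds h2) self_mem_nhdsWithin)
  exact ⟨y, hy, fun h => hyx (congrArg Subtype.val h)⟩

/-- Two maps onto the same finite set, defined on perfect profinite second countable spaces, differ
by a homeomorphism of their domains: corresponding fibres are Cantor spaces. -/
theorem exists_homeomorph_comp_eq {Y Z A : Type*} [TopologicalSpace Y] [CompactSpace Y] [T2Space Y]
    [TotallyDisconnectedSpace Y] [SecondCountableTopology Y] [PerfectSpace Y]
    [TopologicalSpace Z] [CompactSpace Z] [T2Space Z]
    [TotallyDisconnectedSpace Z] [SecondCountableTopology Z] [PerfectSpace Z]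
    [TopologicalSpace A] [DiscreteTopology A] {π : Y → A} {p : Z → A}
    (hπ : Continuous π) (hp : Continuous p) (hπs : π.Surjective) (hps : p.Surjective) :
    ∃ θ : Y ≃ₜ Z, ∀ y, p (θ y) = π y := by
  have key : ∀ a, Nonempty ({y // π y = a} ≃ₜ {z // p z = a}) := by
    intro a
    have hY : IsClopen {y | π y = a} := (isClopen_discrete {a}).preimage hπ
    have hZ : IsClopen {z | p z = a} := (isClopen_discrete {a}).preimage hp
    have : CompactSpace {y // π y = a} := isCompact_iff_compactSpace.1 hY.isClosed.isCompact
    have : CompactSpace {z // p z = a} := isCompact_iff_compactSpace.1 hZ.isClosed.isCompact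
    have : PerfectSpace {y // π y = a} := hY.isOpen.perfectSpace_subtype
    have : PerfectSpace {z // p z = a} := hZ.isOpen.perfectSpace_subtype
    have : SecondCountableTopology {y // π y = a} :=
      Topology.IsInducing.subtypeVal.secondCountableTopology
    have : SecondCountableTopology {z // p z = a} :=
      Topology.IsInducing.subtypeVal.secondCountableTopology
    have : Nonempty {y // π y = a} := let ⟨y, hy⟩ := hπs a; ⟨y, hy⟩
    have : Nonempty {z // p z = a} := let ⟨y, hy⟩ := hps a; ⟨y, hy⟩
    obtain ⟨e⟩ := nonempty_homeomorph_nat_bool {y // π y = a}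
    obtain ⟨e'⟩ := nonempty_homeomorph_nat_bool {z // p z = a}
    exact ⟨e.trans e'.symm⟩
  have h := fun a => (key a).some
  let θ : Y ≃ Z := (Equiv.sigmaFiberEquiv π).symm.trans
    ((Equiv.sigmaCongrRight fun a => (h a).toEquiv).trans (Equiv.sigmaFiberEquiv p))
  have hθ : ∀ a (y : {y // π y = a}), θ y = h a y := by
    rintro a ⟨y, rfl⟩
    rfl
  have hcont : Continuous θ := by
    refine continuous_iff_continuousAt.2 fun y => ?_
    have hY : IsOpen {z | π z = π y} := (isOpen_discrete {π y}).preimage hπ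
    refine ContinuousOn.continuousAt (s := {z | π z = π y}) ?_ (hY.mem_nhds rfl)
    rw [continuousOn_iff_continuous_domRestrict]
    exact (continuous_subtype_val.comp (h (π y)).continuous).congr fun z => (hθ _ z).symm
  exact ⟨hcont.homeoOfEquivCompactToT2, fun y => (h (π y) ⟨y, rfl⟩).2⟩

/-! ### A criterion for a comeager orbit -/

/-- Back-and-forth: in an action of a completely metrizable group, if the local orbits of `x` and of
`y` are dense in neighbourhoods of these points, and `y` is in the closure of the orbit of `x`, then
`x` and `y` lie in the same orbit. -/
theorem exists_smul_eq_of_locally_dense_orbits {G X : Type*} [Group G] [TopologicalSpace G]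
    [IsTopologicalGroup G] [TopologicalSpace X] [MulAction G X] [ContinuousSMul G X]
    [TopologicalSpace.IsCompletelyMetrizableSpace G] [TopologicalSpace.MetrizableSpace X] {x y : X}
    (hx : ∀ V ∈ 𝓝 (1 : G), closure ((· • x) '' V) ∈ 𝓝 x)
    (hy : ∀ V ∈ 𝓝 (1 : G), closure ((· • y) '' V) ∈ 𝓝 y)
    (hxy : y ∈ closure (MulAction.orbit G x)) : ∃ g : G, g • x = y := by
  let _ := TopologicalSpace.metrizableSpaceMetric X
  let _ := TopologicalSpace.upgradeIsCompletelyMetrizable G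
  -- local density passes along the orbit
  have hmove : ∀ {z : X}, (∀ V ∈ 𝓝 (1 : G), closure ((· • z) '' V) ∈ 𝓝 z) →
      ∀ p : G, ∀ V ∈ 𝓝 (1 : G), closure ((· • (p • z)) '' V) ∈ 𝓝 (p • z) := by
    intro z hz p V hV
    have h1 : (fun g => p * g * p⁻¹) ⁻¹' V ∈ 𝓝 (1 : G) := by
      have hc : Continuous fun g : G => p * g * p⁻¹ := by fun_prop
      exact hc.continuousAt.preimage_mem_nhds (by simpa using hV)
    have h2 := (Homeomorph.smul p).isOpenMap.image_mem_nhds (hz _ h1)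
    refine Filter.mem_of_superset h2 ?_
    have h3 := image_closure_subset_closure_image (s := (· • z) '' ((fun g => p * g * p⁻¹) ⁻¹' V))
      (Homeomorph.smul p).continuous
    refine h3.trans (closure_mono ?_)
    rintro _ ⟨_, ⟨g, hg, rfl⟩, rfl⟩
    exact ⟨p * g * p⁻¹, hg, by simp [smul_smul]⟩
  have hnear : ∀ (p : G) (ε : ℝ), 0 < ε → {v : G | dist p (v * p) < ε} ∈ 𝓝 (1 : G) := by
    intro p ε hε
    have hc : Continuous fun v : G => dist p (v * p) := by fun_prop
    exact hc.continuousAt.preimage_mem_nhds (Iio_mem_nhds (by simpa using hε))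
  let ε (n : ℕ) : ℝ := 1 * (1 / 2) ^ n
  have hε : ∀ n, 0 < ε n := fun n => by positivity
  -- a state `(p, q, V)` at stage `n`: elements of `V` move `p` only slightly, and some element of `V`
  -- moves `p • x` as close to `q • y` as one likes
  let P (n : ℕ) (s : G × G × Set G) : Prop := s.2.2 ∈ 𝓝 (1 : G) ∧
    (∀ v ∈ s.2.2, dist s.1 (v * s.1) < ε n) ∧ s.2.1 • y ∈ closure ((· • (s.1 • x)) '' s.2.2)
  -- alternately move `p • x` towards `q • y` and `q • y` towards `p • x`
  have hstep : ∀ n (s : {s // P n s}), ∃ t : {s // P (n + 1) s}, dist s.1.1 t.1.1 < ε n ∧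
      dist s.1.2.1 t.1.2.1 < ε n ∧ dist (t.1.1 • x) (s.1.2.1 • y) < ε n := by
    rintro n ⟨⟨p, q, V⟩, hV, hVp, hq⟩
    dsimp only at hV hVp hq ⊢
    have h1 := hmove hy q _ (hnear q _ (hε n))
    obtain ⟨_, ⟨h2, h3⟩, v, hv, rfl⟩ := mem_closure_iff_nhds.1 hq _
      (Filter.inter_mem h1 (Metric.ball_mem_nhds _ (hε n)))
    dsimp only at h2 h3
    rw [smul_smul] at h2 h3
    have h4 := hmove hx (v * p) _ (hnear (v * p) _ (hε (n + 1)))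
    obtain ⟨_, h5, w, hw, rfl⟩ := mem_closure_iff_nhds.1 h2 _ h4
    dsimp only at h5
    rw [smul_smul] at h5
    exact ⟨⟨(v * p, w * q, _), hnear (v * p) _ (hε (n + 1)), fun _ h => h, h5⟩, hVp v hv, hw, h3⟩
  obtain ⟨s₀⟩ : Nonempty {s // P 0 s} := by
    obtain ⟨_, h1, g₀, rfl⟩ := mem_closure_iff_nhds.1 hxy _ (hy _ Filter.univ_mem)
    obtain ⟨_, h2, w, -, rfl⟩ := mem_closure_iff_nhds.1 h1 _ (hmove hx g₀ _ (hnear g₀ _ (hε 0)))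
    exact ⟨⟨(g₀, w, _), hnear g₀ _ (hε 0), fun _ h => h, h2⟩⟩
  choose next hnext using hstep
  let s (n : ℕ) : {s // P n s} := Nat.rec s₀ next n
  have hs : ∀ n, dist (s n).1.1 (s (n + 1)).1.1 < ε n ∧
      dist (s n).1.2.1 (s (n + 1)).1.2.1 < ε n ∧
      dist ((s (n + 1)).1.1 • x) ((s n).1.2.1 • y) < ε n := fun n => hnext n (s n)
  obtain ⟨g, hg⟩ := cauchySeq_tendsto_of_complete (cauchySeq_of_le_geometric (1 / 2) 1
    (by norm_num) fun n => (hs n).1.le)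
  obtain ⟨h, hh⟩ := cauchySeq_tendsto_of_complete (cauchySeq_of_le_geometric (1 / 2) 1
    (by norm_num) fun n => (hs n).2.1.le)
  have hgx : Filter.Tendsto (fun n => (s (n + 1)).1.1 • x) Filter.atTop (𝓝 (g • x)) :=
    ((Filter.tendsto_add_atTop_iff_nat 1).2 hg).smul_const x
  have hhy : Filter.Tendsto (fun n => (s n).1.2.1 • y) Filter.atTop (𝓝 (h • y)) := hh.smul_const y
  have hd : Filter.Tendsto (fun n => dist ((s (n + 1)).1.1 • x) ((s n).1.2.1 • y)) Filter.atTop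
      (𝓝 0) := by
    refine squeeze_zero (fun _ => dist_nonneg) (fun n => (hs n).2.2.le) ?_
    simpa [ε] using tendsto_pow_atTop_nhds_zero_of_lt_one (r := (2 : ℝ)⁻¹) (by norm_num)
      (by norm_num)
  have heq : g • x = h • y := by
    have := tendsto_nhds_unique (hgx.dist hhy) hd
    exact dist_eq_zero.1 this
  exact ⟨h⁻¹ * g, by rw [mul_smul, heq, inv_smul_smul]⟩

/-- Rosendal's criterion for the existence of a comeager orbit: the action is topologically
transitive and, for every neighbourhood `V` of the identity, the points around which `V` acts in a
topologically transitive way are dense. -/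
theorem exists_orbit_mem_residual {G X : Type*} [Group G] [TopologicalSpace G]
    [IsTopologicalGroup G] [TopologicalSpace X] [MulAction G X] [ContinuousSMul G X]
    [TopologicalSpace.IsCompletelyMetrizableSpace G] [TopologicalSpace.MetrizableSpace X]
    [SecondCountableTopology X] [BaireSpace X] [Nonempty X]
    (htrans : ∀ U W : Set X, IsOpen U → IsOpen W → U.Nonempty → W.Nonempty →
      ∃ g : G, ∃ u ∈ U, g • u ∈ W)
    (hloc : ∀ V ∈ 𝓝 (1 : G), ∀ U : Set X, IsOpen U → U.Nonempty →
      ∃ U' ⊆ U, IsOpen U' ∧ U'.Nonempty ∧ ∀ W W' : Set X, W ⊆ U' → W' ⊆ U' → IsOpen W → IsOpen W' →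
        W.Nonempty → W'.Nonempty → ∃ g ∈ V, ∃ u ∈ W, g • u ∈ W') :
    ∃ x : X, MulAction.orbit G x ∈ residual X := by
  obtain ⟨V, hV⟩ := (𝓝 (1 : G)).exists_antitone_basis
  let B := TopologicalSpace.countableBasis X
  have hB : TopologicalSpace.IsTopologicalBasis B := TopologicalSpace.isBasis_countableBasis X
  -- the points that some element of `S` moves into `W`
  let N (S : Set G) (W : Set X) : Set X := {x | ∃ g ∈ S, g • x ∈ W}
  have hN : ∀ S W, IsOpen W → IsOpen (N S W) := by
    intro S W hW
    have : N S W = ⋃ g ∈ S, (g • ·) ⁻¹' W := by ext; simp [N]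
    rw [this]
    exact isOpen_biUnion fun g _ => hW.preimage (continuous_const_smul g)
  -- `V n` acts on `U` in a topologically transitive way
  let T (n : ℕ) (U : Set X) : Prop := IsOpen U ∧ ∀ W W' : Set X, W ⊆ U → W' ⊆ U → IsOpen W →
    IsOpen W' → W.Nonempty → W'.Nonempty → ∃ g ∈ V n, ∃ u ∈ W, g • u ∈ W'
  have h1 : ∀ᶠ x in residual X, ∀ W ∈ B, x ∈ N Set.univ W := by
    refine (eventually_countable_ball (TopologicalSpace.countable_countableBasis X)).2 fun W hW => ?_
    refine residual_of_dense_open (hN _ _ (hB.isOpen hW)) (dense_iff_inter_open.2 fun U hU hne => ?_)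
    obtain ⟨g, u, hu, hg⟩ := htrans U W hU (hB.isOpen hW) hne
      (TopologicalSpace.nonempty_of_mem_countableBasis hW)
    exact ⟨u, hu, g, trivial, hg⟩
  have h2 : ∀ᶠ x in residual X, ∀ n, x ∈ ⋃₀ {U | T n U} := by
    refine eventually_countable_forall.2 fun n => residual_of_dense_open
      (isOpen_sUnion fun U hU => hU.1) (dense_iff_inter_open.2 fun U hU hne => ?_)
    obtain ⟨U', hU'U, hU', ⟨u, hu⟩, h⟩ := hloc (V n) (hV.mem n) U hU hne
    exact ⟨u, hU'U hu, U', ⟨hU', h⟩, hu⟩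
  -- a generic point is not in the boundary of any of the open sets `N (V n) W`
  have h3 : ∀ᶠ x in residual X, ∀ n, ∀ W ∈ B, x ∈ N (V n) W ∪ (closure (N (V n) W))ᶜ := by
    refine eventually_countable_forall.2 fun n =>
      (eventually_countable_ball (TopologicalSpace.countable_countableBasis X)).2 fun W hW => ?_
    refine residual_of_dense_open ((hN _ _ (hB.isOpen hW)).union isClosed_closure.isOpen_compl) ?_
    intro x
    by_cases hx : x ∈ closure (N (V n) W)
    · exact closure_mono Set.subset_union_left hx
    · exact subset_closure (Or.inr hx)
  have hgood : ∀ᶠ x in residual X, Dense (MulAction.orbit G x) ∧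
      ∀ S ∈ 𝓝 (1 : G), closure ((· • x) '' S) ∈ 𝓝 x := by
    filter_upwards [h1, h2, h3] with x h1 h2 h3
    refine ⟨hB.dense_iff.2 fun W hW _ => ?_, fun S hS => ?_⟩
    · obtain ⟨g, -, hg⟩ := h1 W hW
      exact ⟨_, hg, g, rfl⟩
    · obtain ⟨n, hn⟩ := hV.mem_iff.1 hS
      obtain ⟨U, ⟨hU, hT⟩, hxU⟩ := h2 n
      refine Filter.mem_of_superset (hU.mem_nhds hxU) fun z hz => ?_
      refine mem_closure_iff.2 fun o ho hzo => ?_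
      obtain ⟨W, hW, hzW, hWs⟩ := hB.exists_subset_of_mem_open
        (show z ∈ o ∩ U from ⟨hzo, hz⟩) (ho.inter hU)
      have hcl : x ∈ closure (N (V n) W) := by
        refine mem_closure_iff.2 fun o' ho' hxo' => ?_
        obtain ⟨g, hg, u, hu, hgu⟩ := hT (o' ∩ U) W Set.inter_subset_right
          (hWs.trans Set.inter_subset_right) (ho'.inter hU) (hB.isOpen hW) ⟨x, hxo', hxU⟩ ⟨z, hzW⟩
        exact ⟨u, hu.1, g, hg, hgu⟩
      obtain ⟨g, hg, hgx⟩ := (h3 n W hW).resolve_right fun h => h hcl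
      exact ⟨g • x, (hWs hgx).1, g, hn hg, rfl⟩
  obtain ⟨x, hxd, hx⟩ := (dense_of_mem_residual hgood).nonempty
  refine ⟨x, Filter.mem_of_superset hgood fun y hy => ?_⟩
  exact exists_smul_eq_of_locally_dense_orbits hx hy.2 (hxd y)

/-! ### Labelled systems in which walking away from a root is deterministic -/

/-- A direction `(i, b)` stands for moving along the `i`-th generator (`b = true`) or along its
inverse (`b = false`). -/
abbrev Direction (ι : Type*) := ι × Bool

/-- The opposite direction. -/
def Direction.opp {ι : Type*} (ε : Direction ι) : Direction ι := (ε.1, !ε.2)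

@[simp] theorem Direction.opp_opp {ι : Type*} (ε : Direction ι) : ε.opp.opp = ε := by
  simp [Direction.opp]

/-- The image of a point under one step of the tuple `f` in the direction `ε`. -/
def move {ι X : Type*} [TopologicalSpace X] (f : ι → X ≃ₜ X) (ε : Direction ι) (x : X) : X :=
  if ε.2 then f ε.1 x else (f ε.1).symm x

/-- The image of a point under the successive steps listed in `L`. -/
def walk {ι X : Type*} [TopologicalSpace X] (f : ι → X ≃ₜ X) : List (Direction ι) → X → X
  | [], x => x
  | ε :: L, x => walk f L (move f ε x)

section Move

variable {ι X : Type*} [TopologicalSpace X] (f : ι → X ≃ₜ X)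

@[simp] theorem move_opp_move (ε : Direction ι) (x : X) : move f ε.opp (move f ε x) = x := by
  obtain ⟨i, _ | _⟩ := ε <;> simp [move, Direction.opp]

@[simp] theorem move_move_opp (ε : Direction ι) (x : X) : move f ε (move f ε.opp x) = x := by
  simpa using move_opp_move f ε.opp x

theorem continuous_move (ε : Direction ι) : Continuous (move f ε) := by
  obtain ⟨i, _ | _⟩ := ε
  · exact (f i).symm.continuous
  · exact (f i).continuous

theorem continuous_walk (L : List (Direction ι)) : Continuous (walk f L) := by
  induction L with
  | nil => exact continuous_id
  | cons ε L ih => exact ih.comp (continuous_move f ε)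

end Move

/-- A vertex label `b = (v, δ)` consists of a colour `v` and the direction `δ` in which one walked
to arrive here from the root, so that the root lies in the direction `δ.opp`. The relation
`RootedEdge next S ε b b'` says that a step in the direction `ε` may lead from `b` to `b'`:
either it leads away from the root, and then `b'` is determined by the function `next`, or the
reverse step does so, or it crosses the root edge, whose two ends each see the root beyond the
other one and whose colours may be any pair related by `S ε`. -/
def RootedEdge {ι A : Type*} (next : A → Direction ι → A) (S : Direction ι → A → A → Prop)
    (ε : Direction ι) (b b' : A × Direction ι) : Prop :=
  (b.2 ≠ ε.opp ∧ b' = (next b.1 ε, ε)) ∨ (b'.2 ≠ ε ∧ b = (next b'.1 ε.opp, ε.opp)) ∨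
    (b.2 = ε.opp ∧ b'.2 = ε ∧ S ε b.1 b'.1)

namespace RootedEdge

variable {ι A : Type*} {next : A → Direction ι → A} {S : Direction ι → A → A → Prop}
  {ε : Direction ι} {b b' : A × Direction ι}

theorem opp (hS : ∀ ε a a', S ε a a' → S ε.opp a' a) (h : RootedEdge next S ε b b') :
    RootedEdge next S ε.opp b' b := by
  rcases h with h | h | ⟨h1, h2, h3⟩
  · exact Or.inr (Or.inl (by simpa using h))
  · exact Or.inl (by simpa using h)
  · exact Or.inr (Or.inr ⟨by simpa using h2, h1, hS _ _ _ h3⟩)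

theorem opp_iff (hS : ∀ ε a a', S ε a a' → S ε.opp a' a) :
    RootedEdge next S ε.opp b' b ↔ RootedEdge next S ε b b' :=
  ⟨fun h => by simpa using h.opp hS, fun h => h.opp hS⟩

/-- Every label has a neighbour in every direction. -/
theorem self_next (hn : ∀ a ε, S ε a (next a ε)) : RootedEdge next S ε b (next b.1 ε, ε) := by
  by_cases h : b.2 = ε.opp
  · exact Or.inr (Or.inr ⟨h, rfl, hn _ _⟩)
  · exact Or.inl ⟨h, rfl⟩

/-- Steps away from the root are deterministic. -/
theorem eq_next (h : RootedEdge next S ε b b') (hb : b.2 ≠ ε.opp) : b' = (next b.1 ε, ε) := by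
  rcases h with h | h | h
  · exact h.2
  · exact absurd (congrArg Prod.snd h.2) hb
  · exact absurd h.1 hb

theorem rel (hS : ∀ ε a a', S ε a a' → S ε.opp a' a) (hn : ∀ a ε, S ε a (next a ε))
    (h : RootedEdge next S ε b b') : S ε b.1 b'.1 := by
  rcases h with ⟨-, rfl⟩ | ⟨-, rfl⟩ | h
  · exact hn _ _
  · simpa using hS _ _ _ (hn b'.1 ε.opp)
  · exact h.2.2

end RootedEdge

/-- The labelling `r` of a system `f` uses exactly the edges allowed by `T`. -/
def Realizes {ι X B : Type*} [TopologicalSpace X] (f : ι → X ≃ₜ X) (r : X → B)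
    (T : Direction ι → B → B → Prop) : Prop :=
  ∀ i b b', (∃ x, r x = b ∧ r (f i x) = b') ↔ T (i, true) b b'

theorem Realizes.move_iff {ι X B : Type*} [TopologicalSpace X] {f : ι → X ≃ₜ X} {r : X → B}
    {T : Direction ι → B → B → Prop} (hf : Realizes f r T)
    (hT : ∀ ε b b', T ε.opp b' b ↔ T ε b b') (ε : Direction ι) (b b' : B) :
    (∃ x, r x = b ∧ r (move f ε x) = b') ↔ T ε b b' := by
  obtain ⟨i, _ | _⟩ := ε
  · rw [← hT, show Direction.opp (i, false) = (i, true) from rfl, ← hf]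
    constructor
    · rintro ⟨x, h, h'⟩
      exact ⟨(f i).symm x, h', by simpa using h⟩
    · rintro ⟨x, h, h'⟩
      exact ⟨f i x, h', by simpa [move] using h⟩
  · exact hf i b b'

/-- The labels seen from `x` in the system `f` and from `y` in the system `f'` agree along all walks
of length at most `n`. -/
def AgreeUpTo {ι X B : Type*} [TopologicalSpace X] (f f' : ι → X ≃ₜ X) (r : X → B) (n : ℕ)
    (x y : X) : Prop :=
  ∀ L : List (Direction ι), L.length ≤ n → r (walk f L x) = r (walk f' L y)

section Agree

variable {ι X A : Type*} [TopologicalSpace X] {next : A → Direction ι → A}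
  {S : Direction ι → A → A → Prop} {f f' : ι → X ≃ₜ X} {r : X → A × Direction ι}

theorem AgreeUpTo.mono {m n : ℕ} {x y : X} (h : AgreeUpTo f f' r n x y) (hmn : m ≤ n) :
    AgreeUpTo f f' r m x y := fun L hL => h L (hL.trans hmn)

theorem AgreeUpTo.succ {n : ℕ} {x y : X} (h₀ : r x = r y)
    (h : ∀ ε, AgreeUpTo f f' r n (move f ε x) (move f' ε y)) : AgreeUpTo f f' r (n + 1) x y := by
  rintro (_ | ⟨ε, L⟩) hL
  · exact h₀
  · exact h ε L (Nat.le_of_succ_le_succ hL)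

variable (hS : ∀ ε a a', S ε a a' → S ε.opp a' a)
  (hf : Realizes f r (RootedEdge next S)) (hf' : Realizes f' r (RootedEdge next S))

include hS hf hf'

/-- After a step away from the root, agreement improves by one: the only new information lies
further away from the root, where it is determined. -/
theorem AgreeUpTo.move_away {n : ℕ} {x y : X} {ε : Direction ι} (hx : (r x).2 ≠ ε.opp)
    (h : AgreeUpTo f f' r n x y) : AgreeUpTo f f' r (n + 1) (move f ε x) (move f' ε y) := by
  have hxy : r x = r y := h [] (Nat.zero_le _)
  have e1 := ((hf.move_iff (fun _ _ _ => RootedEdge.opp_iff hS) ε _ _).1 ⟨x, rfl, rfl⟩).eq_next hx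
  have e2 := ((hf'.move_iff (fun _ _ _ => RootedEdge.opp_iff hS) ε _ _).1 ⟨y, rfl, rfl⟩).eq_next
    (hxy ▸ hx)
  have hε : r (move f ε x) = r (move f' ε y) := by rw [e1, e2, hxy]
  induction n generalizing x y ε with
  | zero =>
    refine AgreeUpTo.succ hε fun δ => ?_
    intro L hL
    obtain rfl := List.length_eq_zero_iff.1 (Nat.le_zero.1 hL)
    change r (move f δ (move f ε x)) = r (move f' δ (move f' ε y))
    by_cases hδ : δ = ε.opp
    · subst hδ; simpa using hxy
    · have hne : (r (move f ε x)).2 ≠ δ.opp := by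
        rw [e1]; rintro rfl; simp at hδ
      have e3 := ((hf.move_iff (fun _ _ _ => RootedEdge.opp_iff hS) δ _ _).1
        ⟨_, rfl, rfl⟩).eq_next hne
      have e4 := ((hf'.move_iff (fun _ _ _ => RootedEdge.opp_iff hS) δ _ _).1
        ⟨_, rfl, rfl⟩).eq_next (hε ▸ hne)
      rw [e3, e4, hε]
  | succ n ih =>
    refine AgreeUpTo.succ hε fun δ => ?_
    by_cases hδ : δ = ε.opp
    · subst hδ; simpa using h
    · have hne : (r (move f ε x)).2 ≠ δ.opp := by
        rw [e1]; rintro rfl; simp at hδ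
      have e3 := ((hf.move_iff (fun _ _ _ => RootedEdge.opp_iff hS) δ _ _).1
        ⟨_, rfl, rfl⟩).eq_next hne
      have e4 := ((hf'.move_iff (fun _ _ _ => RootedEdge.opp_iff hS) δ _ _).1
        ⟨_, rfl, rfl⟩).eq_next (hε ▸ hne)
      exact ih hne ((ih hx (h.mono n.le_succ) hxy e1 e2 hε).mono n.le_succ) hε e3 e4
        (by rw [e3, e4, hε])

/-- The labels of the two ends of the root edge determine all other labels. -/
theorem agreeUpTo_of_root {x y : X} {ε : Direction ι} (hx : (r x).2 = ε.opp)
    (hxε : (r (move f ε x)).2 = ε) (h : r x = r y) (hε : r (move f ε x) = r (move f' ε y)) (n : ℕ) :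
    AgreeUpTo f f' r n x y ∧ AgreeUpTo f f' r n (move f ε x) (move f' ε y) := by
  induction n with
  | zero =>
    constructor <;> intro L hL <;> obtain rfl := List.length_eq_zero_iff.1 (Nat.le_zero.1 hL)
    exacts [h, hε]
  | succ n ih =>
    refine ⟨AgreeUpTo.succ h fun δ => ?_, AgreeUpTo.succ hε fun δ => ?_⟩
    · by_cases hδ : δ = ε
      · subst hδ; exact ih.2
      · refine (AgreeUpTo.move_away hS hf hf' ?_ ih.1).mono n.le_succ
        rw [hx]; intro h; exact hδ (by simpa using (congrArg Direction.opp h).symm)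
    · by_cases hδ : δ = ε.opp
      · subst hδ; simpa using ih.1
      · refine (AgreeUpTo.move_away hS hf hf' ?_ ih.2).mono n.le_succ
        rw [hxε]; rintro rfl; simp at hδ

/-- Every finite pattern of labels occurring in `f'` also occurs in `f`: walk from `y` towards the
root, either across the root edge or until the pattern is out of sight, find the label reached there
in `f`, and walk back. -/
theorem exists_agreeUpTo (hn : ∀ a ε, S ε a (next a ε)) (n : ℕ) (y : X) :
    ∃ x, AgreeUpTo f f' r n x y := by
  have hT : ∀ ε b b', RootedEdge next S ε.opp b' b ↔ RootedEdge next S ε b b' :=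
    fun _ _ _ => RootedEdge.opp_iff hS
  induction n generalizing y with
  | zero =>
    obtain ⟨x, hx, -⟩ := (hf.move_iff hT (r y).2 (r y) _).2 (RootedEdge.self_next hn)
    refine ⟨x, fun L hL => ?_⟩
    obtain rfl := List.length_eq_zero_iff.1 (Nat.le_zero.1 hL)
    exact hx
  | succ n ih =>
    -- `y₁` is the neighbour of `y` in the direction of the root
    set δ := (r y).2
    set y₁ := move f' δ.opp y with hy₁
    have hy : y = move f' δ y₁ := by simp [hy₁]
    by_cases h : (r y₁).2 = δ.opp
    · obtain ⟨x, hx, hxy⟩ := (hf.move_iff hT δ (r y₁) (r y)).2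
        ((hf'.move_iff hT δ _ _).1 ⟨y₁, rfl, by rw [hy]⟩)
      refine ⟨move f δ x, ?_⟩
      have := (agreeUpTo_of_root hS hf hf' (x := x) (y := y₁) (ε := δ) (by rw [hx, h])
        (by rw [hxy]) hx (by rw [hxy, ← hy]) (n + 1)).2
      rwa [← hy] at this
    · obtain ⟨x, hx⟩ := ih y₁
      have hxy : r x = r y₁ := hx [] (Nat.zero_le _)
      have := AgreeUpTo.move_away hS hf hf' (ε := δ) (by rwa [hxy]) hx
      rw [← hy] at this
      exact ⟨_, this⟩

end Agree

/-- If `f` and `f'` realize the same rooted edges, then every point `y` has a partner `x`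
whose labels along all walks are those of `y`. -/
theorem exists_forall_walk_eq {ι X A : Type*} [TopologicalSpace X] [CompactSpace X]
    [TopologicalSpace A] [DiscreteTopology A] [TopologicalSpace ι] [DiscreteTopology ι]
    {next : A → Direction ι → A} {S : Direction ι → A → A → Prop} {f f' : ι → X ≃ₜ X}
    {r : X → A × Direction ι} (hr : Continuous r) (hS : ∀ ε a a', S ε a a' → S ε.opp a' a)
    (hn : ∀ a ε, S ε a (next a ε)) (hf : Realizes f r (RootedEdge next S))
    (hf' : Realizes f' r (RootedEdge next S)) (y : X) :
    ∃ x, ∀ L, r (walk f L x) = r (walk f' L y) := by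
  have hclosed : ∀ n, IsClosed {x | AgreeUpTo f f' r n x y} := by
    intro n
    have : {x | AgreeUpTo f f' r n x y} =
        ⋂ (L : List (Direction ι)) (_ : L.length ≤ n), {x | r (walk f L x) = r (walk f' L y)} := by
      ext; simp [AgreeUpTo]
    rw [this]
    exact isClosed_biInter fun L _ =>
      isClosed_eq (hr.comp (continuous_walk f L)) continuous_const
  obtain ⟨x, hx⟩ := IsCompact.nonempty_iInter_of_sequence_nonempty_isCompact_isClosed
    (fun n => {x | AgreeUpTo f f' r n x y}) (fun n x (hx : AgreeUpTo _ _ _ _ _ _) => hx.mono n.le_succ)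
    (fun n => exists_agreeUpTo hS hf hf' hn n y) (hclosed 0).isCompact hclosed
  exact ⟨x, fun L => Set.mem_iInter.1 hx L.length L le_rfl⟩

/-! ### Joint extensions of two systems -/

/-- A continuous surjection between perfect profinite spaces is, up to the accuracy
allowed by a discrete-valued map, a homeomorphism. -/
theorem exists_homeomorph_approx {Y Z A : Type*} [TopologicalSpace Y] [CompactSpace Y] [T2Space Y]
    [TotallyDisconnectedSpace Y] [SecondCountableTopology Y] [PerfectSpace Y]
    [TopologicalSpace Z] [CompactSpace Z] [T2Space Z]
    [TotallyDisconnectedSpace Z] [SecondCountableTopology Z] [PerfectSpace Z]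
    [TopologicalSpace A] [DiscreteTopology A] {π : Y → Z} {p : Z → A}
    (hπ : Continuous π) (hπs : π.Surjective) (hp : Continuous p) :
    ∃ θ : Y ≃ₜ Z, ∀ y, p (θ y) = p (π y) := by
  have hc : Continuous (Set.rangeFactorization p) := hp.subtype_mk _
  obtain ⟨θ, hθ⟩ := exists_homeomorph_comp_eq (hc.comp hπ) hc
    (Set.rangeFactorization_surjective.comp hπs) Set.rangeFactorization_surjective
  exact ⟨θ, fun y => congrArg Subtype.val (hθ y)⟩

/-- Let `K` be a joining of the systems `f` and `f'`, that is, an invariant closed subset of `X × X`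
that projects onto both factors. Multiplying `K` by a Cantor space and identifying the result
with `X` along perturbations of the two projections, one gets a system `h` near `f` with
a conjugate near `f'`; the conjugating map preserves any labelling `r` that agrees along `K`. -/
theorem exists_conj_of_joining {ι X A B : Type*} [TopologicalSpace X] [CompactSpace X] [T2Space X]
    [TotallyDisconnectedSpace X] [SecondCountableTopology X] [PerfectSpace X]
    [TopologicalSpace A] [DiscreteTopology A] [TopologicalSpace B] [DiscreteTopology B]
    {f f' : ι → X ≃ₜ X} {K : Set (X × X)} (hK : IsClosed K)
    (hinv : ∀ i x, x ∈ K ↔ (f i x.1, f' i x.2) ∈ K)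
    (hfst : ∀ x, ∃ y, (x, y) ∈ K) (hsnd : ∀ y, ∃ x, (x, y) ∈ K)
    {p : X → A} (hp : Continuous p) {r : X → B} (hr : Continuous r) (hrK : ∀ x ∈ K, r x.1 = r x.2) :
    ∃ (g : X ≃ₜ X) (h : ι → X ≃ₜ X), (∀ x, r (g x) = r x) ∧
      (∀ i x, ∃ y, p x = p y ∧ p (h i x) = p (f i y)) ∧
      ∀ i x, ∃ y, p x = p y ∧ p ((g * h i * g⁻¹) x) = p (f' i y) := by
  have : CompactSpace K := isCompact_iff_compactSpace.1 hK.isCompact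
  have : SecondCountableTopology K := Topology.IsInducing.subtypeVal.secondCountableTopology
  have : PerfectSpace (K × X) := perfectSpace_prod_right K X
  have hq : Continuous fun x => (p x, r x) := hp.prodMk hr
  let π₁ (y : K × X) : X := y.1.1.1
  let π₂ (y : K × X) : X := y.1.1.2
  have hπ₁ : Continuous π₁ := by fun_prop
  have hπ₂ : Continuous π₂ := by fun_prop
  obtain ⟨θ₁, hθ₁⟩ := exists_homeomorph_approx hπ₁
    (fun x => let ⟨y, hy⟩ := hfst x; ⟨(⟨(x, y), hy⟩, x), rfl⟩) hq
  obtain ⟨θ₂, hθ₂⟩ := exists_homeomorph_approx hπ₂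
    (fun y => let ⟨x, hx⟩ := hsnd y; ⟨(⟨(x, y), hx⟩, y), rfl⟩) hq
  simp only [Prod.mk.injEq] at hθ₁ hθ₂
  let F (i : ι) : K × X ≃ₜ K × X :=
    (((f i).prodCongr (f' i)).subtype (hinv i)).prodCongr (Homeomorph.refl X)
  refine ⟨θ₁.symm.trans θ₂, fun i => (θ₁.symm.trans (F i)).trans θ₁, fun x => ?_, fun i x => ?_,
    fun i x => ?_⟩
  · change r (θ₂ (θ₁.symm x)) = r x
    rw [(hθ₂ _).2, ← hrK _ (θ₁.symm x).1.2]
    simpa using (hθ₁ (θ₁.symm x)).2.symm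
  · refine ⟨π₁ (θ₁.symm x), ?_, (hθ₁ (F i (θ₁.symm x))).1⟩
    simpa using (hθ₁ (θ₁.symm x)).1
  · refine ⟨π₂ (θ₂.symm x), by simpa using (hθ₂ (θ₂.symm x)).1, ?_⟩
    change p (θ₂ (θ₁.symm (θ₁ (F i (θ₁.symm (θ₁ (θ₂.symm x))))))) = _
    rw [θ₁.symm_apply_apply, θ₁.symm_apply_apply]
    exact (hθ₂ (F i (θ₂.symm x))).1

/-! ### The homeomorphism group as a Polish group -/

section Homeo

variable {X : Type*} [TopologicalSpace X] [CompactSpace X] [T2Space X]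

theorem Homeomorph.isInducing_toContinuousMap :
    IsInducing fun f : X ≃ₜ X => (f : C(X, X)) := ⟨rfl⟩

/-- A homeomorphism and its inverse together form a closed condition on pairs of maps. -/
theorem Homeomorph.isClosedEmbedding_prod_inv :
    IsClosedEmbedding fun f : X ≃ₜ X => ((f : C(X, X)), ((f⁻¹ : X ≃ₜ X) : C(X, X))) := by
  have hc : Continuous fun f : X ≃ₜ X => (f : C(X, X)) :=
    Homeomorph.isInducing_toContinuousMap.continuous
  have hcont : Continuous fun f : X ≃ₜ X => ((f : C(X, X)), ((f⁻¹ : X ≃ₜ X) : C(X, X))) :=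
    hc.prodMk (hc.comp continuous_inv)
  refine ⟨⟨?_, ?_⟩, ?_⟩
  · exact IsInducing.of_comp hcont continuous_fst Homeomorph.isInducing_toContinuousMap
  · intro f g h
    exact Homeomorph.ext fun x => DFunLike.congr_fun (congrArg Prod.fst h) x
  · have hr : (Set.range fun f : X ≃ₜ X => ((f : C(X, X)), ((f⁻¹ : X ≃ₜ X) : C(X, X)))) =
        {p : C(X, X) × C(X, X) | p.1.comp p.2 = ContinuousMap.id X} ∩
          {p | p.2.comp p.1 = ContinuousMap.id X} := by
      ext ⟨a, b⟩
      constructor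
      · rintro ⟨f, hf⟩
        obtain ⟨rfl, rfl⟩ := Prod.mk.inj hf
        exact ⟨ContinuousMap.ext fun x => f.apply_symm_apply x,
          ContinuousMap.ext fun x => f.symm_apply_apply x⟩
      · rintro ⟨h1, h2⟩
        refine ⟨⟨⟨a, b, DFunLike.congr_fun h2, DFunLike.congr_fun h1⟩, a.continuous, b.continuous⟩, ?_⟩
        rfl
    rw [hr]
    have h1 : Continuous fun p : C(X, X) × C(X, X) => p.1.comp p.2 :=
      ContinuousMap.continuous_comp'.comp (continuous_snd.prodMk continuous_fst)
    have h2 : Continuous fun p : C(X, X) × C(X, X) => p.2.comp p.1 :=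
      ContinuousMap.continuous_comp'.comp (continuous_fst.prodMk continuous_snd)
    exact (isClosed_eq h1 continuous_const).inter (isClosed_eq h2 continuous_const)

theorem Homeomorph.isCompletelyMetrizableSpace [TopologicalSpace.IsCompletelyMetrizableSpace X] :
    TopologicalSpace.IsCompletelyMetrizableSpace (X ≃ₜ X) := by
  let _ := TopologicalSpace.upgradeIsCompletelyMetrizable X
  exact Homeomorph.isClosedEmbedding_prod_inv.IsCompletelyMetrizableSpace

theorem Homeomorph.secondCountableTopology_self [SecondCountableTopology X] :
    SecondCountableTopology (X ≃ₜ X) :=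
  Homeomorph.isInducing_toContinuousMap.secondCountableTopology

/-- Homeomorphisms close to `f` do not change the values of `r ∘ f`, for `r` locally constant. -/
theorem Homeomorph.eventually_comp_eq {B : Type*} [TopologicalSpace B] [DiscreteTopology B]
    [Finite B] {r : X → B} (hr : Continuous r) (f : X ≃ₜ X) :
    ∀ᶠ h : X ≃ₜ X in 𝓝 f, ∀ x, r (h x) = r (f x) := by
  have : ∀ᶠ h : X ≃ₜ X in 𝓝 f, ∀ b : B, Set.MapsTo h {x | r (f x) = b} {x | r x = b} := by
    refine Filter.eventually_all.2 fun b => ?_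
    have hK : IsCompact {x | r (f x) = b} :=
      ((isClosed_discrete {b}).preimage (hr.comp f.continuous)).isCompact
    have hU : IsOpen {x | r x = b} := (isOpen_discrete {b}).preimage hr
    exact ((ContinuousMap.isOpen_setOfPred_mapsTo hK hU).preimage
      Homeomorph.isInducing_toContinuousMap.continuous).mem_nhds fun x hx => hx
  filter_upwards [this] with h hh x
  exact hh (r (f x)) rfl

end Homeo

/-! ### Prefixes of binary sequences and the topology of the group -/

/-- The first `n` terms of a binary sequence. -/
def binaryPrefix (n : ℕ) (x : ℕ → Bool) : Fin n → Bool := fun i => x i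

theorem continuous_binaryPrefix (n : ℕ) : Continuous (binaryPrefix n) :=
  continuous_pi fun _ => continuous_apply _

theorem binaryPrefix_surjective (n : ℕ) : (binaryPrefix n).Surjective := fun a =>
  ⟨fun k => if h : k < n then a ⟨k, h⟩ else false, funext fun i => by simp [binaryPrefix]⟩

theorem binaryPrefix_eq_of_le {m n : ℕ} (hmn : m ≤ n) {x y : ℕ → Bool}
    (h : binaryPrefix n x = binaryPrefix n y) : binaryPrefix m x = binaryPrefix m y :=
  funext fun i => congrFun h (i.castLE hmn)

theorem exists_binaryPrefix_of_mem_isOpen {U : Set (ℕ → Bool)} (hU : IsOpen U) {x : ℕ → Bool}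
    (hx : x ∈ U) : ∃ n, ∀ y, binaryPrefix n x = binaryPrefix n y → y ∈ U := by
  obtain ⟨_, ⟨z, n, rfl⟩, hxz, hzU⟩ :=
    (PiNat.isTopologicalBasis_cylinders fun _ : ℕ => Bool).exists_subset_of_mem_open hx hU
  refine ⟨n, fun y hy => hzU ?_⟩
  rw [PiNat.mem_cylinder_iff] at hxz ⊢
  exact fun i hi => (congrFun hy ⟨i, hi⟩).symm.trans (hxz i hi)

/-- A property of `x` and `n` that improves with `n`, and depends on a prefix of length `n` only,
holds uniformly on a compact set if it holds pointwise. -/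
theorem IsCompact.exists_forall_binaryPrefix {K : Set (ℕ → Bool)} (hK : IsCompact K)
    {Q : ℕ → (ℕ → Bool) → Prop} (hmono : ∀ m n x, m ≤ n → Q m x → Q n x)
    (hQ : ∀ n x y, binaryPrefix n x = binaryPrefix n y → Q n x → Q n y)
    (h : ∀ x ∈ K, ∃ n, Q n x) : ∃ n, ∀ x ∈ K, Q n x := by
  refine hK.elim_directed_cover (fun n => {x | Q n x}) (fun n => ?_)
    (fun x hx => Set.mem_iUnion.2 (h x hx)) (monotone_nat_of_le_succ
      (f := fun n => {x | Q n x}) fun n x hx => hmono _ _ _ n.le_succ hx).directed_le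
  have : {x | Q n x} = binaryPrefix n ⁻¹' (binaryPrefix n '' {x | Q n x}) := by
    refine (Set.subset_preimage_image _ _).antisymm ?_
    rintro y ⟨x, hx, hxy⟩
    exact hQ n x y hxy hx
  rw [this]
  exact (isOpen_discrete _).preimage (continuous_binaryPrefix n)

theorem Continuous.exists_binaryPrefix_factor {B : Type*} [TopologicalSpace B]
    [DiscreteTopology B] {r : (ℕ → Bool) → B} (hr : Continuous r) :
    ∃ n, ∀ x y, binaryPrefix n x = binaryPrefix n y → r x = r y := by
  obtain ⟨n, hn⟩ := isCompact_univ.exists_forall_binaryPrefix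
    (Q := fun n x => ∀ y, binaryPrefix n x = binaryPrefix n y → r x = r y)
    (fun m n x hmn h y hy => h y (binaryPrefix_eq_of_le hmn hy))
    (fun n x x' hxx' h y hy => (h x' hxx').symm.trans (h y (hxx'.trans hy)))
    (fun x _ => by
      obtain ⟨n, hn⟩ := exists_binaryPrefix_of_mem_isOpen
        ((isOpen_discrete {r x}).preimage hr) (x := x) rfl
      exact ⟨n, fun y hy => (hn y hy).symm⟩)
  exact ⟨n, fun x y => hn x trivial y⟩

/-- The homeomorphisms that agree with `f` on prefixes of length `n` form a neighbourhood basis. -/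
theorem exists_binaryPrefix_of_mem_nhds {f : (ℕ → Bool) ≃ₜ (ℕ → Bool)}
    {W : Set ((ℕ → Bool) ≃ₜ (ℕ → Bool))} (hW : W ∈ 𝓝 f) :
    ∃ n, ∀ h : (ℕ → Bool) ≃ₜ (ℕ → Bool),
      (∀ x, binaryPrefix n (h x) = binaryPrefix n (f x)) → h ∈ W := by
  let F (n : ℕ) : Set C(ℕ → Bool, ℕ → Bool) := {h | ∀ x, binaryPrefix n (h x) = binaryPrefix n (f x)}
  have hF : Antitone F := fun m n hmn h hh x => binaryPrefix_eq_of_le hmn (hh x)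
  have hle : ⨅ n, Filter.principal (F n) ≤ 𝓝 (f : C(ℕ → Bool, ℕ → Bool)) := by
    rw [ContinuousMap.nhds_compactOpen]
    simp only [le_iInf_iff, Filter.le_principal_iff]
    intro K hK U hU hfU
    obtain ⟨n, hn⟩ := (hK.image f.continuous).exists_forall_binaryPrefix
      (Q := fun n z => ∀ y, binaryPrefix n z = binaryPrefix n y → y ∈ U)
      (fun m n z hmn h y hy => h y (binaryPrefix_eq_of_le hmn hy))
      (fun n z z' hzz' h y hy => h y (hzz'.trans hy))
      (fun z hz => exists_binaryPrefix_of_mem_isOpen hU (Set.image_subset_iff.2 hfU hz))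
    exact Filter.mem_iInf_of_mem n fun h hh x hx => hn _ ⟨x, hx, rfl⟩ _ (hh x).symm
  rw [Homeomorph.isInducing_toContinuousMap.nhds_eq_comap] at hW
  obtain ⟨W', hW', hWW'⟩ := hW
  have hdir : Directed (· ≥ ·) fun n => Filter.principal (F n) :=
    Antitone.directed_ge fun m n hmn => Filter.principal_mono.2 (hF hmn)
  obtain ⟨n, hn⟩ := (Filter.mem_iInf_of_directed hdir _).1 (hle hW')
  exact ⟨n, fun h hh => hWW' (hn hh)⟩

/-- A tuple whose graph, seen at a fine enough resolution, is contained in that of `f`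
is close to `f`. -/
theorem exists_binaryPrefix_graph_of_mem_nhds {ι : Type*} [Finite ι]
    {f : ι → (ℕ → Bool) ≃ₜ (ℕ → Bool)} {W : Set (ι → (ℕ → Bool) ≃ₜ (ℕ → Bool))} (hW : W ∈ 𝓝 f) :
    ∃ k, ∀ n, k ≤ n → ∀ h : ι → (ℕ → Bool) ≃ₜ (ℕ → Bool),
      (∀ i x, ∃ y, binaryPrefix n x = binaryPrefix n y ∧
        binaryPrefix n (h i x) = binaryPrefix n (f i y)) → h ∈ W := by
  have := Fintype.ofFinite ι
  rw [nhds_pi, Filter.mem_pi'] at hW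
  obtain ⟨I, V, hV, hVW⟩ := hW
  choose l hl using fun i => exists_binaryPrefix_of_mem_nhds (hV i)
  choose k hk using fun i =>
    ((continuous_binaryPrefix (l i)).comp (f i).continuous).exists_binaryPrefix_factor
  refine ⟨Finset.univ.sup fun i => max (k i) (l i), fun n hn h hh => hVW fun i _ => hl i _ fun x => ?_⟩
  have hi := (Finset.le_sup (f := fun i => max (k i) (l i)) (Finset.mem_univ i)).trans hn
  obtain ⟨y, hxy, hy⟩ := hh i x
  rw [binaryPrefix_eq_of_le ((le_max_right _ _).trans hi) hy]
  exact (hk i x y (binaryPrefix_eq_of_le ((le_max_left _ _).trans hi) hxy)).symm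

/-! ### Ample generics -/

section Conj

variable {ι : Type*} [Finite ι]

/-- A joining of `f` and `f'` yields a conjugacy between tuples arbitrarily close to `f` and
to `f'`. -/
theorem exists_conj_mem_of_joining {B : Type*} [TopologicalSpace B] [DiscreteTopology B]
    {f f' : ι → (ℕ → Bool) ≃ₜ (ℕ → Bool)} {K : Set ((ℕ → Bool) × (ℕ → Bool))} (hK : IsClosed K)
    (hinv : ∀ i x, x ∈ K ↔ (f i x.1, f' i x.2) ∈ K)
    (hfst : ∀ x, ∃ y, (x, y) ∈ K) (hsnd : ∀ y, ∃ x, (x, y) ∈ K)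
    {r : (ℕ → Bool) → B} (hr : Continuous r) (hrK : ∀ x ∈ K, r x.1 = r x.2)
    {W W' : Set (ι → (ℕ → Bool) ≃ₜ (ℕ → Bool))} (hW : W ∈ 𝓝 f) (hW' : W' ∈ 𝓝 f') :
    ∃ g : (ℕ → Bool) ≃ₜ (ℕ → Bool), (∀ x, r (g x) = r x) ∧
      ∃ h ∈ W, (fun i => g * h i * g⁻¹) ∈ W' := by
  have := perfectSpace_nat_bool
  obtain ⟨k, hk⟩ := exists_binaryPrefix_graph_of_mem_nhds hW
  obtain ⟨k', hk'⟩ := exists_binaryPrefix_graph_of_mem_nhds hW'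
  obtain ⟨g, h, hg, h1, h2⟩ := exists_conj_of_joining hK hinv hfst hsnd
    (continuous_binaryPrefix (max k k')) hr hrK
  exact ⟨g, hg, h, hk _ (le_max_left _ _) _ h1, hk' _ (le_max_right _ _) _ h2⟩

theorem exists_conj_mem {f f' : ι → (ℕ → Bool) ≃ₜ (ℕ → Bool)}
    {W W' : Set (ι → (ℕ → Bool) ≃ₜ (ℕ → Bool))} (hW : W ∈ 𝓝 f) (hW' : W' ∈ 𝓝 f') :
    ∃ g : (ℕ → Bool) ≃ₜ (ℕ → Bool), ∃ h ∈ W, (fun i => g * h i * g⁻¹) ∈ W' := by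
  obtain ⟨g, -, h⟩ := exists_conj_mem_of_joining (f := f) (f' := f') (K := Set.univ) isClosed_univ
    (fun _ _ => by simp) (fun x => ⟨x, trivial⟩) (fun x => ⟨x, trivial⟩)
    (r := fun _ => ()) continuous_const (fun _ _ => rfl) hW hW'
  exact ⟨g, h⟩

/-- Two realizations of the same rooted edges have conjugate perturbations, with a conjugating map
that preserves the labels: points with the same labels along all walks form a joining. -/
theorem exists_conj_mem_of_realizes {A : Type*} [TopologicalSpace A] [DiscreteTopology A]
    [TopologicalSpace ι] [DiscreteTopology ι]
    {next : A → Direction ι → A} {S : Direction ι → A → A → Prop}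
    {f f' : ι → (ℕ → Bool) ≃ₜ (ℕ → Bool)} {r : (ℕ → Bool) → A × Direction ι} (hr : Continuous r)
    (hS : ∀ ε a a', S ε a a' → S ε.opp a' a) (hn : ∀ a ε, S ε a (next a ε))
    (hf : Realizes f r (RootedEdge next S)) (hf' : Realizes f' r (RootedEdge next S))
    {W W' : Set (ι → (ℕ → Bool) ≃ₜ (ℕ → Bool))} (hW : W ∈ 𝓝 f) (hW' : W' ∈ 𝓝 f') :
    ∃ g : (ℕ → Bool) ≃ₜ (ℕ → Bool), (∀ x, r (g x) = r x) ∧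
      ∃ h ∈ W, (fun i => g * h i * g⁻¹) ∈ W' := by
  refine exists_conj_mem_of_joining (f := f) (f' := f')
    (K := {x | ∀ L, r (walk f L x.1) = r (walk f' L x.2)}) ?_ (fun i x => ⟨fun h L => ?_, fun h L => ?_⟩)
    (fun x => ?_) (fun y => exists_forall_walk_eq hr hS hn hf hf' y) hr (fun x hx => hx []) hW hW'
  · have : {x : (ℕ → Bool) × (ℕ → Bool) | ∀ L, r (walk f L x.1) = r (walk f' L x.2)} =
        ⋂ L, {x | r (walk f L x.1) = r (walk f' L x.2)} := by ext; simp
    rw [this]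
    exact isClosed_iInter fun L =>
      isClosed_eq (hr.comp ((continuous_walk f L).comp continuous_fst))
        (hr.comp ((continuous_walk f' L).comp continuous_snd))
  · exact h ((i, true) :: L)
  · simpa [walk, move] using h ((i, false) :: L)
  · obtain ⟨y, hy⟩ := exists_forall_walk_eq hr hS hn hf' hf x
    exact ⟨y, fun L => (hy L).symm⟩

/-- Every relation that is total in both directions is the set of pairs of labels
`(r x, r (h x))` of some homeomorphism `h`. -/
theorem exists_homeomorph_realizing {B : Type*} [TopologicalSpace B] [DiscreteTopology B] [Finite B]
    {r : (ℕ → Bool) → B} (hr : Continuous r) (hrs : r.Surjective) {T : B → B → Prop}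
    (hl : ∀ b, ∃ b', T b b') (hl' : ∀ b', ∃ b, T b b') :
    ∃ h : (ℕ → Bool) ≃ₜ (ℕ → Bool), ∀ b b', (∃ x, r x = b ∧ r (h x) = b') ↔ T b b' := by
  have := perfectSpace_nat_bool
  have := perfectSpace_prod_right {p : B × B // T p.1 p.2} (ℕ → Bool)
  obtain ⟨θ₁, hθ₁⟩ := exists_homeomorph_comp_eq
    (Y := {p : B × B // T p.1 p.2} × (ℕ → Bool)) (π := fun y => y.1.1.1) (p := r)
    (by fun_prop) hr (fun b => let ⟨b', h⟩ := hl b; ⟨(⟨(b, b'), h⟩, fun _ => true), rfl⟩) hrs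
  obtain ⟨θ₂, hθ₂⟩ := exists_homeomorph_comp_eq
    (Y := {p : B × B // T p.1 p.2} × (ℕ → Bool)) (π := fun y => y.1.1.2) (p := r)
    (by fun_prop) hr (fun b' => let ⟨b, h⟩ := hl' b'; ⟨(⟨(b, b'), h⟩, fun _ => true), rfl⟩) hrs
  refine ⟨θ₁.symm.trans θ₂, fun b b' => ⟨?_, fun h => ?_⟩⟩
  · rintro ⟨x, rfl, rfl⟩
    have h1 := hθ₁ (θ₁.symm x)
    have h2 := hθ₂ (θ₁.symm x)
    rw [θ₁.apply_symm_apply] at h1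
    rw [Homeomorph.trans_apply, h1, h2]
    exact (θ₁.symm x).1.2
  · refine ⟨θ₁ (⟨(b, b'), h⟩, fun _ => true), hθ₁ _, ?_⟩
    rw [Homeomorph.trans_apply, θ₁.symm_apply_apply, hθ₂]

theorem isOpen_setOf_realizes {B : Type*} [TopologicalSpace B] [DiscreteTopology B] [Finite B]
    {r : (ℕ → Bool) → B} (hr : Continuous r) (T : Direction ι → B → B → Prop) :
    IsOpen {f : ι → (ℕ → Bool) ≃ₜ (ℕ → Bool) | Realizes f r T} := by
  refine isOpen_iff_mem_nhds.2 fun f hf => ?_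
  have : ∀ᶠ h : ι → (ℕ → Bool) ≃ₜ (ℕ → Bool) in 𝓝 f, ∀ i x, r (h i x) = r (f i x) :=
    Filter.eventually_all.2 fun i => ((continuous_apply i).tendsto f).eventually
      (Homeomorph.eventually_comp_eq hr (f i))
  filter_upwards [this] with h hh i b b'
  simp only [hh]
  exact hf i b b'

/-- Every nonempty open set of tuples contains a nonempty open set on which conjugation by elements
of a given neighbourhood `V` of the identity is topologically transitive: the set of tuples that
realize suitable rooted edges. Colours are prefixes of length `max k₁ k₂`, the root edge carries any
pair of prefixes linked by `f₀`, and away from the root a fixed choice `next` of links is followed.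
Such a tuple is close to `f₀`, and a map preserving the labels preserves the prefixes, so it is
close to the identity. -/
theorem exists_locally_transitive (ι : Type*) [Finite ι] [Nonempty ι]
    {V : Set ((ℕ → Bool) ≃ₜ (ℕ → Bool))} (hV : V ∈ 𝓝 1)
    {U : Set (ι → (ℕ → Bool) ≃ₜ (ℕ → Bool))} (hU : IsOpen U) (hne : U.Nonempty) :
    ∃ U' ⊆ U, IsOpen U' ∧ U'.Nonempty ∧ ∀ f ∈ U', ∀ f' ∈ U', ∀ W ∈ 𝓝 f, ∀ W' ∈ 𝓝 f',
      ∃ g ∈ V, ∃ h ∈ W, (fun i => g * h i * g⁻¹) ∈ W' := by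
  have := perfectSpace_nat_bool
  let _ : TopologicalSpace ι := ⊥
  have : DiscreteTopology ι := ⟨rfl⟩
  obtain ⟨f₀, hf₀⟩ := hne
  obtain ⟨k₁, hk₁⟩ := exists_binaryPrefix_of_mem_nhds hV
  obtain ⟨k₂, hk₂⟩ := exists_binaryPrefix_graph_of_mem_nhds (hU.mem_nhds hf₀)
  let p := binaryPrefix (max k₁ k₂)
  let S (ε : Direction ι) (a a' : Fin (max k₁ k₂) → Bool) : Prop :=
    ∃ x, p x = a ∧ p (move f₀ ε x) = a'
  have hS : ∀ ε a a', S ε a a' → S ε.opp a' a := by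
    rintro ε a a' ⟨x, rfl, rfl⟩
    exact ⟨move f₀ ε x, rfl, by simp⟩
  have hex : ∀ a ε, ∃ a', S ε a a' := by
    intro a ε
    obtain ⟨x, rfl⟩ := binaryPrefix_surjective _ a
    exact ⟨_, x, rfl, rfl⟩
  choose next hn using hex
  have := perfectSpace_prod_right ((Fin (max k₁ k₂) → Bool) × Direction ι) (ℕ → Bool)
  -- cutting each cylinder `p ⁻¹' {a}` into pieces labelled by the directions
  obtain ⟨θ, hθ⟩ := exists_homeomorph_comp_eq (p := p)
    (π := fun y : ((Fin (max k₁ k₂) → Bool) × Direction ι) × (ℕ → Bool) => y.1.1)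
    (by fun_prop) (continuous_binaryPrefix _)
    (fun a => ⟨((a, Classical.arbitrary _), fun _ => true), rfl⟩) (binaryPrefix_surjective _)
  let r (x : ℕ → Bool) : (Fin (max k₁ k₂) → Bool) × Direction ι := (θ.symm x).1
  have hr : Continuous r := continuous_fst.comp θ.symm.continuous
  have hrs : r.Surjective := fun b => ⟨θ (b, fun _ => true), by simp [r]⟩
  have hrp : ∀ x, (r x).1 = p x := fun x => by
    have := hθ (θ.symm x)
    rw [θ.apply_symm_apply] at this
    exact this.symm
  refine ⟨{f | Realizes f r (RootedEdge next S)}, fun f hf => ?_, isOpen_setOf_realizes hr _, ?_, ?_⟩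
  · refine hk₂ (max k₁ k₂) (le_max_right k₁ k₂) f fun i x => ?_
    obtain ⟨y, hy, hy'⟩ := ((hf i _ _).1 ⟨x, rfl, rfl⟩).rel hS hn
    rw [hrp] at hy hy'
    exact ⟨y, hy.symm, hy'.symm⟩
  · choose f hf using fun i : ι => exists_homeomorph_realizing hr hrs
      (T := RootedEdge next S (i, true)) (fun b => ⟨_, RootedEdge.self_next hn⟩)
      (fun b => ⟨_, (RootedEdge.self_next (ε := Direction.opp (i, true)) hn).opp hS⟩)
    exact ⟨f, hf⟩
  · intro f hf f' hf' W hW W' hW'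
    obtain ⟨g, hg, h⟩ := exists_conj_mem_of_realizes hr hS hn hf hf' hW hW'
    refine ⟨g, hk₁ g fun x => ?_, h⟩
    refine binaryPrefix_eq_of_le (le_max_left k₁ k₂) ?_
    change p (g x) = p x
    rw [← hrp, ← hrp, hg]

end Conj

theorem theorem1p1 : HasAmpleGenerics ((ℕ → Bool) ≃ₜ (ℕ → Bool)) := by
  intro m
  let _ : TopologicalSpace (ConjAct ((ℕ → Bool) ≃ₜ (ℕ → Bool))) :=
    inferInstanceAs (TopologicalSpace ((ℕ → Bool) ≃ₜ (ℕ → Bool)))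
  have : IsTopologicalGroup (ConjAct ((ℕ → Bool) ≃ₜ (ℕ → Bool))) :=
    inferInstanceAs (IsTopologicalGroup ((ℕ → Bool) ≃ₜ (ℕ → Bool)))
  have := Homeomorph.isCompletelyMetrizableSpace (X := ℕ → Bool)
  have : TopologicalSpace.IsCompletelyMetrizableSpace (ConjAct ((ℕ → Bool) ≃ₜ (ℕ → Bool))) := this
  have := Homeomorph.secondCountableTopology_self (X := ℕ → Bool)
  have : ContinuousSMul (ConjAct ((ℕ → Bool) ≃ₜ (ℕ → Bool)))
      (Fin m → (ℕ → Bool) ≃ₜ (ℕ → Bool)) := by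
    refine ⟨continuous_pi fun i => ?_⟩
    have h1 : Continuous fun q : ((ℕ → Bool) ≃ₜ (ℕ → Bool)) ×
        (Fin m → (ℕ → Bool) ≃ₜ (ℕ → Bool)) => q.1 * q.2 i * q.1⁻¹ := by fun_prop
    exact h1
  rcases Nat.eq_zero_or_pos m with rfl | hm
  · -- there are no directions for `m = 0`, but then the space of tuples is a point
    refine ⟨fun i => i.elim0, Filter.mem_of_superset Filter.univ_mem fun h _ => ?_⟩
    rw [Subsingleton.elim h]
    exact MulAction.mem_orbit_self _
  have : Nonempty (Fin m) := ⟨⟨0, hm⟩⟩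
  refine exists_orbit_mem_residual ?_ ?_
  · rintro U W hU hW ⟨f, hf⟩ ⟨f', hf'⟩
    exact exists_conj_mem (hU.mem_nhds hf) (hW.mem_nhds hf')
  · intro V hV U hU hne
    obtain ⟨U', h1, h2, h3, h4⟩ := exists_locally_transitive (Fin m) (V := V) hV hU hne
    refine ⟨U', h1, h2, h3, ?_⟩
    rintro W W' hWU hWU' hW hW' ⟨f, hf⟩ ⟨f', hf'⟩
    exact h4 f (hWU hf) f' (hWU' hf') W (hW.mem_nhds hf) W' (hW'.mem_nhds hf')
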